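/- Let $(\Omega,\mathcal F,\mathbb P)$ be a complete probability space, $\sigma:\Omega\to\Omega$ an ergodic measure preserving automorphism (invertible, with measurable inverse), $R>0$, and $\omega\mapsto c(\omega)$ a measurable map from $\Omega$ to the disc $\mathbb D(0,R)\subset\mathbb C$. Put $f_\omega(z)=z^2+c(\omega)$ and $f^n_\omega=f_{\sigma^{n-1}\omega}\circ\dots\circ f_\omega$. Let $\mathcal A_\omega=\{z\in\mathbb C: f^n_\omega(z)\to\infty\}$, let $$g_\omega(z)=\lim_{n\to\infty}\frac1{2^n}\ln|f^n_\omega(z)|\quad (z\in\mathcal A_\omega),\qquad g_\omega(z)=0\quad (z\notin\mathcal A_\omega),$$ and let $\mu_\omega=\frac1{2\pi}\Delta g_\omega$, where $\Delta$ is the Laplacian in the sense of distributions on $\mathbb C$. Let $\mu$ be the global measure on $(\Omega\times\mathbb C,\mathcal F\otimes\mathcal B)$, where $\mathcal B$ is the Borel $\sigma$-algebra of $\mathbb C$, given by $$\mu(A)=\int_\Omega \mu_\omega(\{z:(\omega,z)\in A\})\,d\mathbb P(\omega),$$ and let $F(\omega,z)=(\sigma\omega,f_\omega(z))$ on $\Omega\times\mathbb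 C$. These objects are well defined: the limit defining $g_\omega$ exists on $\mathcal A_\omega$ for every $\omega$; $g_\omega$ is locally integrable and $\mu_\omega$ is a Borel probability measure on $\mathbb C$ for every $\omega$; $\omega\mapsto\mu_\omega(B)$ is measurable for every $B\in\mathcal B$; and the formula for $\mu(A)$ defines a measure. Moreover, the map $F$ is measurable with respect to $\mathcal F\otimes\mathcal B$, and $\mu$ is $F$-invariant. In particular, for every $\mu$-measurable set $A$ (a set measurable for the $\mu$-completion of $\mathcal F\otimes\mathcal B$), the set $F^{-1}(A)$ is $\mu$-measurable and $\mu(F^{-1}(A))=\mu(A)$. -/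

import Mathlib

open MeasureTheory Filter Topology Laplacian

noncomputable section

/-- A bounded random system of quadratic maps over the probability space `(Ω, P)`: an ergodic
measure preserving automorphism `shift` of `(Ω, P)`, a constant `R > 0`, and a measurable choice of
parameters `c ω` in the open disc of radius `R` about `0`. -/
structure BoundedQuadraticSystem (Ω : Type*) [MeasurableSpace Ω] (P : Measure Ω) where
  shift : Ω ≃ᵐ Ω
  ergodic_shift : Ergodic shift P
  R : ℝ
  R_pos : 0 < R
  c : Ω → ℂ
  measurable_c : Measurable c
  c_mem : ∀ ω, c ω ∈ Metric.ball (0 : ℂ) R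

/-- `Δ u = m` in the sense of distributions on the plane: `u` is locally integrable, `m` is a
locally finite Borel measure, and `∫ φ dm = ∫ u Δφ dx dy` for every real-valued smooth `φ` with
compact support. -/
def HasDistribLaplacian (u : ℂ → ℝ) (m : Measure ℂ) : Prop :=
  LocallyIntegrable u volume ∧ IsFiniteMeasureOnCompacts m ∧
    ∀ φ : ℂ → ℝ, ContDiff ℝ (⊤ : ℕ∞) φ → HasCompactSupport φ →
      ∫ z, φ z ∂m = ∫ z, u z * (Δ φ) z

open Classical in
/-- The distributional Laplacian of `u`, as a measure (and `0` if it is not a measure). -/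
def distribLaplacian (u : ℂ → ℝ) : Measure ℂ :=
  if h : ∃ m : Measure ℂ, HasDistribLaplacian u m then h.choose else 0

namespace BoundedQuadraticSystem

variable {Ω : Type*} [MeasurableSpace Ω] {P : Measure Ω} (S : BoundedQuadraticSystem Ω P)

/-- The quadratic polynomial `f_ω(z) = z² + c(ω)`. -/
def f (ω : Ω) (z : ℂ) : ℂ := z ^ 2 + S.c ω

/-- The random iterates `f^n_ω = f_{σ^{n-1} ω} ∘ ⋯ ∘ f_ω`. -/
def iter (ω : Ω) : ℕ → ℂ → ℂ
  | 0, z => z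
  | n + 1, z => S.f (S.shift^[n] ω) (iter ω n z)

/-- The basin of infinity `A_ω`. -/
def basin (ω : Ω) : Set ℂ :=
  {z | Tendsto (fun n => S.iter ω n z) atTop (Bornology.cobounded ℂ)}

open Classical in
/-- The Green function `g_ω` of the basin of infinity with pole at infinity, extended by `0`. -/
def green (ω : Ω) (z : ℂ) : ℝ :=
  if z ∈ S.basin ω then
    limUnder atTop (fun n : ℕ => 1 / (2 : ℝ) ^ n * Real.log ‖S.iter ω n z‖)
  else 0

/-- The equilibrium (harmonic) measure `μ_ω = (1 / 2π) Δ g_ω`. -/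
def equilibriumMeasure (ω : Ω) : Measure ℂ :=
  ENNReal.ofReal (1 / (2 * Real.pi)) • distribLaplacian (S.green ω)

/-- The global measure on `Ω × ℂ` with fibers `μ_ω`, i.e. `∫ δ_ω ⊗ μ_ω dP(ω)`. -/
def globalMeasure : Measure (Ω × ℂ) :=
  P.bind fun ω => (S.equilibriumMeasure ω).map (Prod.mk ω)

/-- The skew product `F(ω, z) = (σ ω, f_ω(z))`. -/
def skewProduct (p : Ω × ℂ) : Ω × ℂ := (S.shift p.1, S.f p.1 p.2)

end BoundedQuadraticSystem

end

noncomputable section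

/-! Replace `log |z|` by the smooth potential `s(z) = ½ log (1 + |z|²)` and put `g_n = s ∘ f^n_ω /
2^n`. Since `s(z² + c) - 2 s(z)` is bounded uniformly in `z` and in `|c| ≤ R`, the `g_n` converge
uniformly on the whole plane at rate `2^{-n}`. The limit is the Green function: on the basin `s` and
`log |·|` differ by a bounded amount, and off it a positive limit would force escape. Hence `g_ω` is
continuous, jointly measurable, and `g_{σω} ∘ f_ω = 2 g_ω`.

Each `Δ g_n` is nonnegative of mass `2π`: the Fubini-Study mass is doubled by a pullback of degree
two and halved by the normalization. A vague cluster point of these densities is `Δ g_ω`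
(`exists_hasDistribLaplacian`), and rescaled cutoffs show that no mass escapes to infinity
(`HasDistribLaplacian.measure_univ`).

For invariance, test `μ_ω` against `φ ∘ f_ω`. Conformal covariance of `Δ`, the functional equation
and the double covering give `(f_ω)_* μ_ω = μ_{σω}` (`map_equilibriumMeasure`). Integrating over
`P`, which `σ` preserves, gives invariance of the global measure. -/

/-! ### The Laplacian on the plane: Green's identity and conformal covariance. -/

theorem laplacian_complex_apply {φ : ℂ → ℝ} (z : ℂ) :
    (Δ φ) z = fderiv ℝ (fderiv ℝ φ) z 1 1 + fderiv ℝ (fderiv ℝ φ) z Complex.I Complex.I := by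
  rw [InnerProductSpace.laplacian_eq_iteratedFDeriv_complexPlane]
  simp [iteratedFDeriv_two_apply]

theorem ContDiff.continuous_laplacian {φ : ℂ → ℝ} (hφ : ContDiff ℝ (⊤ : ℕ∞) φ) :
    Continuous (Δ φ) := by
  have h1 : ContDiff ℝ (⊤ : ℕ∞) (fderiv ℝ φ) := hφ.fderiv_right (by simp)
  have h2 : Continuous (fderiv ℝ (fderiv ℝ φ)) := h1.continuous_fderiv (by simp)
  have : (Δ φ) = fun z => fderiv ℝ (fderiv ℝ φ) z 1 1
      + fderiv ℝ (fderiv ℝ φ) z Complex.I Complex.I := funext laplacian_complex_apply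
  rw [this]
  fun_prop

theorem HasCompactSupport.laplacian {φ : ℂ → ℝ} (hφ : HasCompactSupport φ) :
    HasCompactSupport (Δ φ) := by
  have h2 : HasCompactSupport (fderiv ℝ (fderiv ℝ φ)) := (hφ.fderiv ℝ).fderiv ℝ
  refine h2.mono ?_
  intro z hz h0
  apply hz
  rw [laplacian_complex_apply, h0]
  simp

theorem ContDiff.hasFDerivAt_fderiv_apply {φ : ℂ → ℝ} (hφ : ContDiff ℝ (⊤ : ℕ∞) φ) (v z : ℂ) :
    HasFDerivAt (fun x => fderiv ℝ φ x v) ((fderiv ℝ (fderiv ℝ φ) z).flip v) z := by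
  have h1 : ContDiff ℝ (⊤ : ℕ∞) (fderiv ℝ φ) := hφ.fderiv_right (by simp)
  have h2 := (h1.differentiable (by simp) z).hasFDerivAt
  refine (h2.clm_apply (hasFDerivAt_const v z)).congr_fderiv ?_
  ext w
  all_goals simp

/-- Green's second identity on the plane, for a compactly supported test function. -/
theorem integral_mul_laplacian_comm {u φ : ℂ → ℝ} (hu : ContDiff ℝ (⊤ : ℕ∞) u)
    (hφ : ContDiff ℝ (⊤ : ℕ∞) φ) (hc : HasCompactSupport φ) :
    ∫ z, u z * (Δ φ) z = ∫ z, φ z * (Δ u) z := by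
  have du : ContDiff ℝ (⊤ : ℕ∞) (fderiv ℝ u) := hu.fderiv_right (by simp)
  have dφ : ContDiff ℝ (⊤ : ℕ∞) (fderiv ℝ φ) := hφ.fderiv_right (by simp)
  have cu := hu.continuous
  have cφ := hφ.continuous
  have cdu := du.continuous
  have cdφ := dφ.continuous
  have cddu : Continuous (fderiv ℝ (fderiv ℝ u)) := du.continuous_fderiv (by simp)
  have cddφ : Continuous (fderiv ℝ (fderiv ℝ φ)) := dφ.continuous_fderiv (by simp)
  have s1 : HasCompactSupport (fderiv ℝ φ) := hc.fderiv ℝ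
  have s2 : HasCompactSupport (fderiv ℝ (fderiv ℝ φ)) := s1.fderiv ℝ
  have int0 : ∀ a : ℂ → ℝ, Continuous a → Integrable (fun z => a z * φ z) := fun a ha =>
    (ha.mul cφ).integrable_of_hasCompactSupport hc.mul_left
  have s1v : ∀ v, HasCompactSupport (fun z => fderiv ℝ φ z v) := fun v =>
    s1.mono (fun z hz h0 => hz (by simp [h0]))
  have s2v : ∀ v, HasCompactSupport (fun z => fderiv ℝ (fderiv ℝ φ) z v v) := fun v =>
    s2.mono (fun z hz h0 => hz (by simp [h0]))
  have int1 : ∀ a : ℂ → ℝ, Continuous a → ∀ v, Integrable (fun z => a z * fderiv ℝ φ z v) :=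
    fun a ha v => (ha.mul (by fun_prop)).integrable_of_hasCompactSupport (s1v v).mul_left
  have int2 : ∀ a : ℂ → ℝ, Continuous a → ∀ v,
      Integrable (fun z => a z * fderiv ℝ (fderiv ℝ φ) z v v) :=
    fun a ha v => (ha.mul (by fun_prop)).integrable_of_hasCompactSupport (s2v v).mul_left
  have key : ∀ v : ℂ, ∫ z, u z * fderiv ℝ (fderiv ℝ φ) z v v
      = ∫ z, φ z * fderiv ℝ (fderiv ℝ u) z v v := by
    intro v
    have e1 : ∀ z, fderiv ℝ (fun x => fderiv ℝ φ x v) z v = fderiv ℝ (fderiv ℝ φ) z v v :=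
      fun z => by rw [(hφ.hasFDerivAt_fderiv_apply v z).fderiv]; rfl
    have e2 : ∀ z, fderiv ℝ (fun x => fderiv ℝ u x v) z v = fderiv ℝ (fderiv ℝ u) z v v :=
      fun z => by rw [(hu.hasFDerivAt_fderiv_apply v z).fderiv]; rfl
    have a1 := integral_mul_fderiv_eq_neg_fderiv_mul_of_integrable (μ := (volume : Measure ℂ))
      (f := u) (g := fun x => fderiv ℝ φ x v) (v := v)
      (int1 _ (by fun_prop) v) (by simpa only [e1] using int2 u cu v) (int1 u cu v)
      (fun z _ => hu.differentiable (by simp) z)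
      (fun z _ => (hφ.hasFDerivAt_fderiv_apply v z).differentiableAt)
    have a2 := integral_mul_fderiv_eq_neg_fderiv_mul_of_integrable (μ := (volume : Measure ℂ))
      (f := fun x => fderiv ℝ u x v) (g := φ) (v := v)
      (by simpa only [e2] using int0 _ (by fun_prop)) (int1 _ (by fun_prop) v)
      (int0 _ (by fun_prop))
      (fun z _ => (hu.hasFDerivAt_fderiv_apply v z).differentiableAt)
      (fun z _ => hφ.differentiable (by simp) z)
    simp only [e1] at a1
    simp only [e2] at a2
    rw [a1, a2, neg_neg]
    simp only [mul_comm]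
  simp only [laplacian_complex_apply, mul_add]
  rw [integral_add (int2 u cu _) (int2 u cu _), integral_add, key, key]
  · simpa only [mul_comm] using int0 (fun z => fderiv ℝ (fderiv ℝ u) z 1 1) (by fun_prop)
  · simpa only [mul_comm] using
      int0 (fun z => fderiv ℝ (fderiv ℝ u) z Complex.I Complex.I) (by fun_prop)

/-- Conformal covariance of the Laplacian under a quadratic polynomial. -/
theorem laplacian_comp_sq_add {φ : ℂ → ℝ} (hφ : ContDiff ℝ (⊤ : ℕ∞) φ) (c z : ℂ) :
    (Δ fun z => φ (z ^ 2 + c)) z = (Δ φ) (z ^ 2 + c) * ‖2 * z‖ ^ 2 := by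
  have dφ : ContDiff ℝ (⊤ : ℕ∞) (fderiv ℝ φ) := hφ.fderiv_right (by simp)
  set L : ℂ → (ℂ →L[ℝ] ℂ) := fun z => ContinuousLinearMap.mul ℝ ℂ (2 * z) with hL
  have hf : ∀ z : ℂ, HasFDerivAt (fun z : ℂ => z ^ 2 + c) (L z) z := by
    intro z
    have := ((hasDerivAt_pow 2 z).add_const c).complexToReal_fderiv
    refine this.congr_fderiv ?_
    ext
    all_goals simp [hL]
  have h1 : ∀ z, fderiv ℝ (fun z => φ (z ^ 2 + c)) z = (fderiv ℝ φ (z ^ 2 + c)).comp (L z) :=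
    fun z => ((hφ.differentiable (by simp) _).hasFDerivAt.comp z (hf z)).fderiv
  have hcomp : ContDiff ℝ (⊤ : ℕ∞) (fun z => φ (z ^ 2 + c)) := hφ.comp (by fun_prop)
  have h2 : ∀ v, fderiv ℝ (fderiv ℝ (fun z => φ (z ^ 2 + c))) z v v
      = fderiv ℝ (fderiv ℝ φ) (z ^ 2 + c) (2 * z * v) (2 * z * v)
        + fderiv ℝ φ (z ^ 2 + c) (2 * v * v) := by
    intro v
    have e1 := (hcomp.hasFDerivAt_fderiv_apply v z)
    simp only [h1] at e1
    have e2 : HasFDerivAt (fun x : ℂ => 2 * x * v) ((2 * v) • ContinuousLinearMap.id ℝ ℂ) z := by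
      have := (((hasFDerivAt_id (𝕜 := ℝ) z).const_mul 2).mul_const v)
      refine HasFDerivAt.congr_fderiv this ?_
      ext
      all_goals simp; ring
    have e3 := (((dφ.differentiable (by simp) _).hasFDerivAt.comp z (hf z)).clm_apply e2)
    have e5 : (fun x => (fderiv ℝ φ (x ^ 2 + c) ∘SL L x) v)
        = fun y => ((fderiv ℝ φ ∘ fun z => z ^ 2 + c) y) (2 * y * v) := by
      ext x
      simp [hL]
    have := congrArg (fun T => T v) (e1.unique (e5 ▸ e3))
    simp only [ContinuousLinearMap.flip_apply] at this
    simpa [hL, add_comm, mul_assoc] using this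
  -- The pair `a, a * I` is an orthogonal basis whose vectors both have length `‖a‖`, so the trace
  -- scales by `‖a‖ ^ 2`; the cross terms cancel without any symmetry of `B`.
  have hbil : ∀ (B : ℂ →L[ℝ] ℂ →L[ℝ] ℝ) (a : ℂ), B (a * 1) (a * 1)
      + B (a * Complex.I) (a * Complex.I) = (B 1 1 + B Complex.I Complex.I) * ‖a‖ ^ 2 := by
    intro B a
    have ea : a * 1 = a.re • (1 : ℂ) + a.im • Complex.I := by
      apply Complex.ext <;> simp
    have eb : a * Complex.I = (-a.im) • (1 : ℂ) + a.re • Complex.I := by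
      apply Complex.ext <;> simp
    rw [ea, eb, Complex.sq_norm, Complex.normSq_apply]
    simp only [map_add, map_smul, add_apply, smul_apply,
      smul_eq_mul]
    ring
  rw [laplacian_complex_apply, laplacian_complex_apply, h2, h2, ← hbil]
  -- The first-order terms in the directions `1` and `I` cancel: this is harmonicity of the
  -- polynomial.
  have : (2 : ℂ) * Complex.I * Complex.I = -(2 * 1 * 1) := by
    rw [mul_assoc, Complex.I_mul_I]; ring
  rw [this, map_neg]
  ring

/-! ### The spherical potential and its mass. -/

/-- The smooth radial potential `½ log (1 + |z|²)`, whose Laplacian is the Fubini-Study density. -/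
def sphericalPotential (z : ℂ) : ℝ := 1 / 2 * Real.log (1 + ‖z‖ ^ 2)

theorem contDiff_sphericalPotential : ContDiff ℝ (⊤ : ℕ∞) sphericalPotential := by
  unfold sphericalPotential
  refine contDiff_const.mul (ContDiff.log (contDiff_const.add (contDiff_norm_sq ℝ)) fun z => ?_)
  positivity

theorem laplacian_sphericalPotential (z : ℂ) :
    (Δ sphericalPotential) z = 2 / (1 + ‖z‖ ^ 2) ^ 2 := by
  have hn : ∀ z : ℂ, HasFDerivAt (fun z : ℂ => 1 + ‖z‖ ^ 2) (2 • innerSL ℝ z) z := fun z =>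
    ((hasStrictFDerivAt_norm_sq z).hasFDerivAt.const_add 1)
  have hpos : ∀ z : ℂ, (1 : ℝ) + ‖z‖ ^ 2 ≠ 0 := fun z => by positivity
  have h1 : ∀ z : ℂ, HasFDerivAt sphericalPotential ((1 + ‖z‖ ^ 2)⁻¹ • innerSL ℝ z) z := by
    intro z
    refine (((hn z).log (hpos z)).const_mul (1 / 2)).congr_fderiv ?_
    ext
    all_goals simp; ring
  have h2 : ∀ v : ℂ, fderiv ℝ (fderiv ℝ sphericalPotential) z v v
      = (1 + ‖z‖ ^ 2)⁻¹ * ‖v‖ ^ 2 - 2 * ((1 + ‖z‖ ^ 2)⁻¹) ^ 2 * (inner ℝ z v) ^ 2 := by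
    intro v
    have e1 := contDiff_sphericalPotential.hasFDerivAt_fderiv_apply v z
    have e0 : (fun x => fderiv ℝ sphericalPotential x v)
        = fun x => (1 + ‖x‖ ^ 2)⁻¹ * inner ℝ v x := by
      ext x
      rw [(h1 x).fderiv]
      simp [real_inner_comm]
    rw [e0] at e1
    have e2 : HasFDerivAt (fun x : ℂ => (1 + ‖x‖ ^ 2)⁻¹)
        (-((1 + ‖z‖ ^ 2) ^ 2)⁻¹ • (2 • innerSL ℝ z)) z :=
      (hasDerivAt_inv (hpos z)).comp_hasFDerivAt z (hn z)
    have e3 := e2.mul (innerSL ℝ v).hasFDerivAt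
    have := congrArg (fun T => T v) (e1.unique e3)
    simp only [ContinuousLinearMap.flip_apply] at this
    rw [this]
    simp [real_inner_comm v z]
    ring
  rw [laplacian_complex_apply, h2, h2]
  have i1 : inner ℝ z (1 : ℂ) = z.re := by simp [Complex.inner]
  have i2 : inner ℝ z Complex.I = z.im := by simp [Complex.inner]
  have := hpos z
  rw [i1, i2, norm_one, Complex.norm_I]
  have e : z.re ^ 2 = ‖z‖ ^ 2 - z.im ^ 2 := by rw [Complex.sq_norm, Complex.normSq_apply]; ring
  rw [e]
  field_simp
  ring

theorem lintegral_laplacian_sphericalPotential :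
    ∫⁻ z, ENNReal.ofReal ((Δ sphericalPotential) z) = ENNReal.ofReal (2 * Real.pi) := by
  have hd : ∀ x ∈ Set.Ici (0 : ℝ), HasDerivAt (fun x : ℝ => -(1 + x ^ 2)⁻¹)
      (x * (2 / (1 + x ^ 2) ^ 2)) x := by
    intro x _
    have h : HasDerivAt (fun x : ℝ => 1 + x ^ 2) (2 * x) x := by
      simpa using (hasDerivAt_pow 2 x).const_add 1
    convert! (h.inv (by positivity)).neg using 1
    field_simp
  have ht : Tendsto (fun x : ℝ => -(1 + x ^ 2)⁻¹) atTop (𝓝 0) := by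
    have : Tendsto (fun x : ℝ => 1 + x ^ 2) atTop atTop :=
      tendsto_atTop_add_const_left _ _ (tendsto_pow_atTop (by norm_num))
    simpa using (tendsto_inv_atTop_zero.comp this).neg
  have h1 : ∫ x in Set.Ioi (0 : ℝ), x * (2 / (1 + x ^ 2) ^ 2) = 1 := by
    have := integral_Ioi_of_hasDerivAt_of_nonneg' hd
      (fun x (hx : 0 < x) => by positivity) ht
    simpa using this
  have h2 : ∫ z : ℂ, 2 / (1 + ‖z‖ ^ 2) ^ 2 = 2 * Real.pi := by
    rw [integral_fun_norm_addHaar volume (fun x => 2 / (1 + x ^ 2) ^ 2)]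
    simp only [Complex.finrank_real_complex, Nat.add_one_sub_one, pow_one, smul_eq_mul, h1,
      Measure.real, Complex.volume_ball]
    simp
  simp only [laplacian_sphericalPotential]
  rw [← ofReal_integral_eq_lintegral_ofReal, h2]
  -- Integrability comes for free: a non-integrable function would have Bochner integral `0`, not
  -- `2π`.
  · by_contra h
    rw [integral_undef h] at h2
    have := Real.pi_pos
    linarith
  · exact Eventually.of_forall fun z => by positivity

/-! ### Change of variables under a quadratic polynomial. -/

theorem Complex.det_mul_restrictScalars (a : ℂ) :
    (ContinuousLinearMap.mul ℝ ℂ a).det = ‖a‖ ^ 2 := by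
  have : (ContinuousLinearMap.mul ℝ ℂ a).det = Algebra.norm ℝ a := rfl
  rw [this, Algebra.norm_complex_apply, Complex.sq_norm]

theorem Complex.hasFDerivAt_sq_add (c z : ℂ) :
    HasFDerivAt (fun z : ℂ => z ^ 2 + c) (ContinuousLinearMap.mul ℝ ℂ (2 * z)) z := by
  refine ((hasDerivAt_pow 2 z).add_const c).complexToReal_fderiv.congr_fderiv ?_
  ext
  all_goals simp

theorem Complex.volume_re_eq_zero : volume {z : ℂ | z.re = 0} = 0 := by
  have := Measure.addHaar_submodule (volume : Measure ℂ) (LinearMap.ker Complex.reLm) (by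
    intro h
    have : (1 : ℂ) ∈ LinearMap.ker Complex.reLm := h ▸ Submodule.mem_top
    simp at this)
  convert this using 2
  ext z
  simp

theorem Complex.volume_compl_slitPlane : volume Complex.slitPlaneᶜ = 0 := by
  have := Measure.addHaar_submodule (volume : Measure ℂ) (LinearMap.ker Complex.imLm) (by
    intro h
    have : Complex.I ∈ LinearMap.ker Complex.imLm := h ▸ Submodule.mem_top
    simp at this)
  refine measure_mono_null (fun z hz => ?_) this
  simp only [Set.mem_compl_iff, Complex.mem_slitPlane_iff, not_or, not_not] at hz
  simpa using hz.2

/-- A quadratic polynomial covers the plane twice. -/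
theorem lintegral_comp_sq_add (k : ℂ → ENNReal) (c : ℂ) :
    ∫⁻ z, ENNReal.ofReal (‖2 * z‖ ^ 2) * k (z ^ 2 + c) = 2 * ∫⁻ z, k z := by
  -- Squaring maps each of the open right and left half-planes bijectively onto the slit plane; the
  -- imaginary axis and the slit are null.
  have half : ∀ s : Set ℂ, MeasurableSet s → Set.InjOn (fun z : ℂ => z ^ 2) s →
      (fun z : ℂ => z ^ 2) '' s = Complex.slitPlane →
      ∫⁻ z in s, ENNReal.ofReal (‖2 * z‖ ^ 2) * k (z ^ 2 + c) = ∫⁻ z, k z := by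
    intro s hs hinj him
    have := lintegral_image_eq_lintegral_abs_det_fderiv_mul (volume : Measure ℂ) hs
      (fun z _ => by simpa using (Complex.hasFDerivAt_sq_add 0 z).hasFDerivWithinAt) hinj
      (fun z => k (z + c))
    simp only [Complex.det_mul_restrictScalars, abs_pow, abs_norm] at this
    rw [← this, him, ← lintegral_add_right_eq_self k c]
    rw [setLIntegral_congr (ae_eq_univ.2 Complex.volume_compl_slitPlane), setLIntegral_univ]
  have hsplit : ({z : ℂ | 0 < z.re} ∪ {z : ℂ | z.re < 0} : Set ℂ) =ᵐ[volume] Set.univ := by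
    rw [ae_eq_univ]
    refine measure_mono_null (fun z hz => ?_) Complex.volume_re_eq_zero
    simp only [Set.mem_compl_iff, Set.mem_union, Set.mem_ofPred_eq, not_or, not_lt] at hz ⊢
    exact le_antisymm hz.1 hz.2
  have m1 : MeasurableSet {z : ℂ | 0 < z.re} :=
    measurableSet_lt measurable_const Complex.measurable_re
  have m2 : MeasurableSet {z : ℂ | z.re < 0} :=
    measurableSet_lt Complex.measurable_re measurable_const
  have im1 : ∀ z : ℂ, z.re ≠ 0 → z ^ 2 ∈ Complex.slitPlane := by
    intro z hz
    rw [Complex.mem_slitPlane_iff]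
    by_cases h : z.im = 0
    · left
      have : 0 < z.re ^ 2 := by positivity
      simp [pow_two, h] at this ⊢
      exact this
    · right
      simp only [pow_two, Complex.mul_im]
      intro h0
      apply mul_ne_zero hz h
      linarith
  have sq : ∀ w ∈ Complex.slitPlane, ∃ z : ℂ, 0 < z.re ∧ z ^ 2 = w := by
    intro w hw
    refine ⟨w ^ (1 / 2 : ℂ), ?_, ?_⟩
    · have hw0 := Complex.slitPlane_ne_zero hw
      rw [Complex.cpow_def_of_ne_zero hw0, Complex.exp_re]
      refine mul_pos (Real.exp_pos _) (Real.cos_pos_of_mem_Ioo ?_)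
      have e : (Complex.log w * (1 / 2)).im = w.arg / 2 := by
        have : Complex.log w * (1 / 2) = ((1 / 2 : ℝ) : ℂ) * Complex.log w := by push_cast; ring
        rw [this, Complex.im_ofReal_mul, Complex.log_im]
        ring
      rw [e]
      have h1 := Complex.neg_pi_lt_arg w
      have h2 := lt_of_le_of_ne (Complex.arg_le_pi w) (Complex.slitPlane_arg_ne_pi hw)
      constructor <;> linarith
    · rw [← Complex.cpow_nat_mul]
      simp
  rw [← setLIntegral_univ, ← setLIntegral_congr hsplit, lintegral_union m2, half _ m1, half _ m2,
    two_mul]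
  · intro a ha b hb hab
    rcases sq_eq_sq_iff_eq_or_eq_neg.1 hab with h | h
    · exact h
    · rw [h] at ha
      simp only [Set.mem_ofPred_eq, Complex.neg_re] at ha hb
      linarith
  · apply Set.Subset.antisymm
    · rintro _ ⟨z, hz, rfl⟩
      exact im1 z hz.ne
    · intro w hw
      obtain ⟨z, hz, h⟩ := sq w hw
      exact ⟨-z, by simpa using hz, by simpa using h⟩
  · intro a ha b hb hab
    rcases sq_eq_sq_iff_eq_or_eq_neg.1 hab with h | h
    · exact h
    · rw [h] at ha
      simp only [Set.mem_ofPred_eq, Complex.neg_re] at ha hb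
      linarith
  · apply Set.Subset.antisymm
    · rintro _ ⟨z, hz, rfl⟩
      exact im1 z (ne_of_gt hz)
    · intro w hw
      obtain ⟨z, hz, h⟩ := sq w hw
      exact ⟨z, hz, h⟩
  · rw [Set.disjoint_left]
    intro z hz hz'
    simp only [Set.mem_ofPred_eq] at hz hz'
    linarith

/-- The double covering as an identity of measures, which transfers signed Bochner integrals without
splitting them by sign. -/
theorem map_withDensity_sq_add (c : ℂ) :
    ((volume : Measure ℂ).withDensity fun z => ENNReal.ofReal (‖2 * z‖ ^ 2)).map
      (fun z => z ^ 2 + c) = (2 : ENNReal) • volume := by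
  have hm : Measurable fun z : ℂ => z ^ 2 + c := by fun_prop
  ext s hs
  rw [Measure.map_apply hm hs, withDensity_apply _ (hm hs), ← lintegral_indicator (hm hs)]
  have := lintegral_comp_sq_add (s.indicator 1) c
  rw [lintegral_indicator_one hs] at this
  rw [Measure.smul_apply, smul_eq_mul, ← this]
  congr 1
  ext z
  by_cases h : z ^ 2 + c ∈ s <;> simp [Set.indicator, h]

theorem integral_comp_sq_add {k : ℂ → ℝ} (hk : AEStronglyMeasurable k volume) (c : ℂ) :
    ∫ z, k (z ^ 2 + c) * ‖2 * z‖ ^ 2 = 2 * ∫ z, k z := by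
  have h : ∫ z, k z ∂((2 : ENNReal) • (volume : Measure ℂ)) = 2 * ∫ z, k z := by
    rw [integral_smul_measure]; simp
  rw [← h, ← map_withDensity_sq_add c, integral_map (by fun_prop),
    integral_withDensity_eq_integral_toReal_smul (by fun_prop)
      (Eventually.of_forall fun _ => ENNReal.ofReal_lt_top)]
  · refine integral_congr_ae (Eventually.of_forall fun z => ?_)
    simp only [smul_eq_mul]
    rw [ENNReal.toReal_ofReal (by positivity), mul_comm]
  · rw [map_withDensity_sq_add]
    exact hk.smul_measure _

/-! ### Growth of the spherical potential. -/

theorem sphericalPotential_nonneg (z : ℂ) : 0 ≤ sphericalPotential z :=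
  mul_nonneg (by norm_num) (Real.log_nonneg (by nlinarith [sq_nonneg ‖z‖]))

/-- The quantities `(1 + |z|²)²` and `1 + |z² + c|²` agree up to the factor `2 (1 + R)²` in both
directions. Uniformity in `z` and `c` is what makes the convergence to the Green function uniform.
-/
theorem abs_sphericalPotential_sub_le {R : ℝ} {c : ℂ} (hc : ‖c‖ ≤ R) (z : ℂ) :
    |sphericalPotential (z ^ 2 + c) - 2 * sphericalPotential z|
      ≤ 1 / 2 * Real.log (2 * (1 + R) ^ 2) := by
  have hR : 0 ≤ R := (norm_nonneg c).trans hc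
  have hz := norm_nonneg z
  have hw := norm_nonneg (z ^ 2 + c)
  have h1 : ‖z ^ 2 + c‖ ≤ ‖z‖ ^ 2 + R := by
    refine (norm_add_le _ _).trans ?_
    rw [norm_pow]
    linarith
  have h2 : ‖z‖ ^ 2 ≤ ‖z ^ 2 + c‖ + R := by
    have := norm_sub_le (z ^ 2 + c) c
    rw [add_sub_cancel_right, norm_pow] at this
    linarith
  set a := ‖z‖ ^ 2 with ha
  set b := ‖z ^ 2 + c‖ with hb
  have ha0 : 0 ≤ a := sq_nonneg _
  have hup : 1 + b ^ 2 ≤ 2 * (1 + R) ^ 2 * (1 + a) ^ 2 := by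
    have e1 : 1 + b ≤ (1 + R) * (1 + a) := by nlinarith [mul_nonneg hR ha0]
    have e2 : (1 + b) ^ 2 ≤ ((1 + R) * (1 + a)) ^ 2 := by gcongr
    nlinarith [sq_nonneg ((1 + R) * (1 + a))]
  have hlow : (1 + a) ^ 2 ≤ 2 * (1 + R) ^ 2 * (1 + b ^ 2) := by
    have e1 : 1 + a ≤ (1 + R) * (1 + b) := by nlinarith [mul_nonneg hR hw]
    have e2 : (1 + a) ^ 2 ≤ ((1 + R) * (1 + b)) ^ 2 := by gcongr
    have e3 : (1 + b) ^ 2 ≤ 2 * (1 + b ^ 2) := by nlinarith [sq_nonneg (1 - b)]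
    calc (1 + a) ^ 2 ≤ (1 + R) ^ 2 * (1 + b) ^ 2 := by rw [← mul_pow]; exact e2
      _ ≤ (1 + R) ^ 2 * (2 * (1 + b ^ 2)) := by gcongr
      _ = _ := by ring
  have l1 := Real.log_le_log (by positivity) hup
  have l2 := Real.log_le_log (by positivity) hlow
  rw [Real.log_mul (by positivity) (by positivity), Real.log_pow] at l1
  rw [Real.log_mul (by positivity) (by positivity), Real.log_pow] at l2
  simp only [sphericalPotential, ← ha, ← hb]
  rw [abs_le]
  push_cast at l1 l2
  constructor <;> linarith

theorem abs_sphericalPotential_sub_log_le {z : ℂ} (hz : 1 ≤ ‖z‖) :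
    |sphericalPotential z - Real.log ‖z‖| ≤ 1 / 2 * Real.log 2 := by
  have h1 : ‖z‖ ^ 2 ≤ 1 + ‖z‖ ^ 2 := by linarith
  have h2 : 1 + ‖z‖ ^ 2 ≤ 2 * ‖z‖ ^ 2 := by nlinarith
  have l1 := Real.log_le_log (by positivity) h1
  have l2 := Real.log_le_log (by positivity) h2
  rw [Real.log_mul (by positivity) (by positivity), Real.log_pow] at l2
  rw [Real.log_pow] at l1
  push_cast at l1 l2
  have := Real.log_nonneg (one_le_two)
  rw [abs_le, sphericalPotential]
  constructor <;> linarith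

theorem tendsto_sphericalPotential_atTop_iff {ι : Type*} {l : Filter ι} {u : ι → ℂ} :
    Tendsto (fun i => sphericalPotential (u i)) l atTop ↔
      Tendsto u l (Bornology.cobounded ℂ) := by
  rw [← tendsto_norm_atTop_iff_cobounded]
  constructor
  · intro h
    rw [tendsto_atTop] at h ⊢
    intro b
    filter_upwards [h (1 / 2 * Real.log (1 + |b| ^ 2) + 1)] with i hi
    by_contra hlt
    push Not at hlt
    have hb : ‖u i‖ ≤ |b| := hlt.le.trans (le_abs_self b)
    have : Real.log (1 + ‖u i‖ ^ 2) ≤ Real.log (1 + |b| ^ 2) :=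
      Real.log_le_log (by positivity) (by gcongr)
    simp only [sphericalPotential] at hi
    linarith
  · intro h
    refine Tendsto.const_mul_atTop (by norm_num) (Real.tendsto_log_atTop.comp ?_)
    exact tendsto_atTop_add_const_left _ _ ((tendsto_pow_atTop (by norm_num)).comp h)

/-! ### The Green function as a uniform limit of smooth potentials. -/

namespace BoundedQuadraticSystem

variable {Ω : Type*} [MeasurableSpace Ω] {P : Measure Ω} (S : BoundedQuadraticSystem Ω P)

/-- The definition peels off the last map; peeling off the first instead is what relates the fibers
over `ω` and `S.shift ω`. -/
theorem iter_succ (ω : Ω) (n : ℕ) (z : ℂ) :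
    S.iter ω (n + 1) z = S.iter (S.shift ω) n (z ^ 2 + S.c ω) := by
  induction n with
  | zero => rfl
  | succ n ih =>
    rw [iter, ih, iter]
    rfl

theorem norm_c_le (ω : Ω) : ‖S.c ω‖ ≤ S.R := by
  simpa using (Metric.mem_ball.1 (S.c_mem ω)).le

/-- Smooth approximations of the Green function. -/
def approxGreen (n : ℕ) (ω : Ω) (z : ℂ) : ℝ := sphericalPotential (S.iter ω n z) / 2 ^ n

/-- The constant in the rate of convergence of the smooth approximations. -/
def rate : ℝ := 1 / 2 * Real.log (2 * (1 + S.R) ^ 2)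

theorem dist_approxGreen_succ_le (n : ℕ) (ω : Ω) (z : ℂ) :
    dist (S.approxGreen n ω z) (S.approxGreen (n + 1) ω z) ≤ S.rate / 2 / 2 ^ n := by
  rw [dist_comm, Real.dist_eq, approxGreen, approxGreen]
  have e : sphericalPotential (S.iter ω (n + 1) z) / 2 ^ (n + 1)
      - sphericalPotential (S.iter ω n z) / 2 ^ n
      = (sphericalPotential (S.iter ω n z ^ 2 + S.c (S.shift^[n] ω))
        - 2 * sphericalPotential (S.iter ω n z)) / 2 / 2 ^ n := by
    rw [iter, f, pow_succ]
    field_simp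
    ring
  rw [e, abs_div, abs_div, abs_of_pos (by positivity : (0 : ℝ) < 2 ^ n), abs_two]
  gcongr
  exact abs_sphericalPotential_sub_le (S.norm_c_le _) _

theorem exists_tendsto_approxGreen (ω : Ω) (z : ℂ) :
    ∃ a, Tendsto (fun n => S.approxGreen n ω z) atTop (𝓝 a) :=
  cauchySeq_tendsto_of_complete
    (cauchySeq_of_le_geometric_two fun n => S.dist_approxGreen_succ_le n ω z)

theorem tendsto_log_of_tendsto_approxGreen {ω : Ω} {z : ℂ} (hz : z ∈ S.basin ω) {a : ℝ}
    (ha : Tendsto (fun n => S.approxGreen n ω z) atTop (𝓝 a)) :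
    Tendsto (fun n : ℕ => 1 / (2 : ℝ) ^ n * Real.log ‖S.iter ω n z‖) atTop (𝓝 a) := by
  have hinv : Tendsto (fun n : ℕ => 1 / 2 * Real.log 2 * (1 / 2 : ℝ) ^ n) atTop (𝓝 0) := by
    simpa using (tendsto_pow_atTop_nhds_zero_of_lt_one (r := (1 / 2 : ℝ)) (by norm_num)
      (by norm_num)).const_mul (1 / 2 * Real.log 2)
  have hz' : Tendsto (fun n => ‖S.iter ω n z‖) atTop atTop :=
    tendsto_norm_atTop_iff_cobounded.2 hz
  have hdiff : Tendsto (fun n : ℕ => S.approxGreen n ω z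
      - 1 / (2 : ℝ) ^ n * Real.log ‖S.iter ω n z‖) atTop (𝓝 0) := by
    refine squeeze_zero_norm' ?_ hinv
    filter_upwards [hz'.eventually_ge_atTop 1] with n hn
    have e : S.approxGreen n ω z - 1 / (2 : ℝ) ^ n * Real.log ‖S.iter ω n z‖
        = (sphericalPotential (S.iter ω n z) - Real.log ‖S.iter ω n z‖) * (1 / 2) ^ n := by
      rw [approxGreen, one_div_pow]
      ring
    rw [e, norm_mul, Real.norm_eq_abs, Real.norm_of_nonneg (by positivity)]
    gcongr
    exact abs_sphericalPotential_sub_log_le hn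
  simpa using ha.sub hdiff

/-- On the basin the logarithmic limit is the same. Off it, a limit `a > 0` would make the potential
of the orbit grow like `a * 2 ^ n`, so the orbit would escape. -/
theorem tendsto_approxGreen (ω : Ω) (z : ℂ) :
    Tendsto (fun n => S.approxGreen n ω z) atTop (𝓝 (S.green ω z)) := by
  obtain ⟨a, ha⟩ := S.exists_tendsto_approxGreen ω z
  suffices h : S.green ω z = a by rwa [h]
  by_cases hz : z ∈ S.basin ω
  · rw [green, if_pos hz]
    exact (S.tendsto_log_of_tendsto_approxGreen hz ha).limUnder_eq
  · rw [green, if_neg hz]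
    have ha0 : 0 ≤ a := ge_of_tendsto' ha fun n =>
      div_nonneg (sphericalPotential_nonneg _) (by positivity)
    by_contra hne
    have hpos : 0 < a := lt_of_le_of_ne ha0 hne
    apply hz
    have h2 : Tendsto (fun n : ℕ => (2 : ℝ) ^ n) atTop atTop :=
      tendsto_pow_atTop_atTop_of_one_lt (by norm_num)
    refine tendsto_sphericalPotential_atTop_iff.1 ((ha.pos_mul_atTop hpos h2).congr fun n => ?_)
    rw [approxGreen]
    field_simp

theorem tendsto_green (ω : Ω) (z : ℂ) (hz : z ∈ S.basin ω) :
    Tendsto (fun n : ℕ => 1 / (2 : ℝ) ^ n * Real.log ‖S.iter ω n z‖) atTop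
      (𝓝 (S.green ω z)) :=
  S.tendsto_log_of_tendsto_approxGreen hz (S.tendsto_approxGreen ω z)

theorem abs_approxGreen_sub_green_le (n : ℕ) (ω : Ω) (z : ℂ) :
    |S.approxGreen n ω z - S.green ω z| ≤ S.rate / 2 ^ n :=
  dist_le_of_le_geometric_two_of_tendsto (fun n => S.dist_approxGreen_succ_le n ω z)
    (S.tendsto_approxGreen ω z) n

theorem tendsto_rate_div : Tendsto (fun n : ℕ => S.rate / 2 ^ n) atTop (𝓝 0) :=
  tendsto_const_nhds.div_atTop (tendsto_pow_atTop_atTop_of_one_lt (by norm_num))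

theorem green_shift (ω : Ω) (z : ℂ) :
    S.green (S.shift ω) (z ^ 2 + S.c ω) = 2 * S.green ω z := by
  refine tendsto_nhds_unique (S.tendsto_approxGreen (S.shift ω) (z ^ 2 + S.c ω)) ?_
  refine (((tendsto_add_atTop_iff_nat 1).2 (S.tendsto_approxGreen ω z)).const_mul 2).congr
    fun n => ?_
  rw [approxGreen, approxGreen, iter_succ, pow_succ]
  field_simp
  ring

theorem contDiff_iter (ω : Ω) (n : ℕ) : ContDiff ℝ (⊤ : ℕ∞) (S.iter ω n) := by
  induction n with
  | zero => exact contDiff_id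
  | succ n ih => exact (ih.pow 2).add contDiff_const

theorem contDiff_approxGreen (n : ℕ) (ω : Ω) : ContDiff ℝ (⊤ : ℕ∞) (S.approxGreen n ω) :=
  (contDiff_sphericalPotential.comp (S.contDiff_iter ω n)).div_const _

theorem continuous_green (ω : Ω) : Continuous (S.green ω) := by
  have : TendstoUniformly (fun n => S.approxGreen n ω) (S.green ω) atTop := by
    rw [Metric.tendstoUniformly_iff]
    intro ε hε
    filter_upwards [S.tendsto_rate_div.eventually_lt_const hε] with n hn z
    rw [dist_comm]
    exact (S.abs_approxGreen_sub_green_le n ω z).trans_lt hn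
  exact this.continuous (Frequently.of_forall fun n => (S.contDiff_approxGreen n ω).continuous)

theorem measurable_iter (n : ℕ) : Measurable fun p : Ω × ℂ => S.iter p.1 n p.2 := by
  induction n with
  | zero => exact measurable_snd
  | succ n ih =>
    exact (ih.pow_const 2).add
      (S.measurable_c.comp ((S.shift.measurable.iterate n).comp measurable_fst))

theorem measurable_green : Measurable fun p : Ω × ℂ => S.green p.1 p.2 := by
  refine measurable_of_tendsto_metrizable (f := fun n (p : Ω × ℂ) => S.approxGreen n p.1 p.2)
    (fun n => ?_) (tendsto_pi_nhds.2 fun p => S.tendsto_approxGreen p.1 p.2)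
  exact (contDiff_sphericalPotential.continuous.measurable.comp
    (S.measurable_iter n)).div_const _

theorem laplacian_approxGreen_succ (n : ℕ) (ω : Ω) (z : ℂ) :
    (Δ (S.approxGreen (n + 1) ω)) z
      = 1 / 2 * ((Δ (S.approxGreen n (S.shift ω))) (z ^ 2 + S.c ω) * ‖2 * z‖ ^ 2) := by
  have e : S.approxGreen (n + 1) ω
      = (1 / 2 : ℝ) • fun z => S.approxGreen n (S.shift ω) (z ^ 2 + S.c ω) := by
    ext z
    simp only [approxGreen, iter_succ, pow_succ, Pi.smul_apply, smul_eq_mul]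
    field_simp
  have hcd := S.contDiff_approxGreen n (S.shift ω)
  have hcd' : ContDiff ℝ (⊤ : ℕ∞) fun z => S.approxGreen n (S.shift ω) (z ^ 2 + S.c ω) :=
    hcd.comp (by fun_prop)
  rw [e, InnerProductSpace.laplacian_smul _ (hcd'.of_le (by norm_cast)).contDiffAt,
    laplacian_comp_sq_add hcd, smul_eq_mul]

theorem approxGreen_zero (ω : Ω) : S.approxGreen 0 ω = sphericalPotential := by
  ext z
  simp [approxGreen, iter]

theorem laplacian_approxGreen_nonneg (n : ℕ) (ω : Ω) (z : ℂ) :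
    0 ≤ (Δ (S.approxGreen n ω)) z := by
  induction n generalizing ω z with
  | zero =>
    rw [approxGreen_zero, laplacian_sphericalPotential]
    positivity
  | succ n ih =>
    rw [laplacian_approxGreen_succ]
    have := ih (S.shift ω) (z ^ 2 + S.c ω)
    positivity

/-- Induction over all fibers at once: the degree two of the covering cancels the factor `1 / 2` in
`laplacian_approxGreen_succ`. -/
theorem lintegral_laplacian_approxGreen (n : ℕ) (ω : Ω) :
    ∫⁻ z, ENNReal.ofReal ((Δ (S.approxGreen n ω)) z) = ENNReal.ofReal (2 * Real.pi) := by
  induction n generalizing ω with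
  | zero => rw [approxGreen_zero, lintegral_laplacian_sphericalPotential]
  | succ n ih =>
    have e : ∀ z, ENNReal.ofReal ((Δ (S.approxGreen (n + 1) ω)) z)
        = ENNReal.ofReal (1 / 2) * (ENNReal.ofReal (‖2 * z‖ ^ 2)
          * ENNReal.ofReal ((Δ (S.approxGreen n (S.shift ω))) (z ^ 2 + S.c ω))) := by
      intro z
      rw [laplacian_approxGreen_succ, ENNReal.ofReal_mul (by norm_num),
        ENNReal.ofReal_mul (S.laplacian_approxGreen_nonneg _ _ _), mul_comm (ENNReal.ofReal _)
          (ENNReal.ofReal (_ ^ 2))]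
    simp only [e]
    rw [lintegral_const_mul' _ _ ENNReal.ofReal_ne_top,
      lintegral_comp_sq_add (fun w => ENNReal.ofReal ((Δ (S.approxGreen n (S.shift ω))) w)),
      ih, ← mul_assoc]
    have : ENNReal.ofReal (1 / 2) * 2 = 1 := by
      rw [← ENNReal.ofReal_ofNat 2, ← ENNReal.ofReal_mul (by norm_num)]
      norm_num
    rw [this, one_mul]

end BoundedQuadraticSystem

/-! ### Vague limits and smooth test functions. -/

/-- A sequence of measures of constant mass has a vague cluster point. -/
theorem exists_vague_limit {X : Type*} [TopologicalSpace X] [T2Space X] [LocallyCompactSpace X]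
    [MeasurableSpace X] [BorelSpace X] (m : ℕ → Measure X) {C : ℝ} (hC : 0 ≤ C)
    (hm : ∀ n, m n Set.univ = ENNReal.ofReal C) :
    ∃ ν : Measure X, IsFiniteMeasureOnCompacts ν ∧ ∀ (g : CompactlySupportedContinuousMap X ℝ)
      (l : ℝ), Tendsto (fun n => ∫ x, g x ∂m n) atTop (𝓝 l) → ∫ x, g x ∂ν = l := by
  have hfin : ∀ n, IsFiniteMeasure (m n) := fun n => ⟨by rw [hm]; exact ENNReal.ofReal_lt_top⟩
  have hint : ∀ (g : CompactlySupportedContinuousMap X ℝ) n, Integrable g (m n) := fun g n =>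
    g.continuous.integrable_of_hasCompactSupport g.hasCompactSupport
  -- Along an ultrafilter the bounded integrals converge for every `g` simultaneously, so no
  -- diagonal extraction is needed; a free one refines `atTop` and so respects genuine limits.
  let 𝒰 : Ultrafilter ℕ := hyperfilter ℕ
  have L (g : CompactlySupportedContinuousMap X ℝ) :
      ∃ x ∈ Metric.closedBall (0 : ℝ) (‖g.toBoundedContinuousFunction‖ * C),
      Tendsto (fun n => ∫ x, g x ∂m n) 𝒰 (𝓝 x) := by
    refine (isCompact_closedBall _ _).ultrafilter_le_nhds'
      (𝒰.map fun n => ∫ x, g x ∂m n) ?_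
    rw [Ultrafilter.mem_map]
    refine Eventually.of_forall fun n => ?_
    change ∫ x, g x ∂m n ∈ _
    rw [mem_closedBall_zero_iff]
    have := norm_integral_le_of_norm_le_const (μ := m n)
      (Eventually.of_forall g.toBoundedContinuousFunction.norm_coe_le_norm)
    rwa [Measure.real, hm, ENNReal.toReal_ofReal hC] at this
  choose Λ _ hΛ using L
  let Λ' : CompactlySupportedContinuousMap X ℝ →ₚ[ℝ] ℝ :=
  { toFun := Λ
    map_add' g g' := by
      refine tendsto_nhds_unique (hΛ (g + g')) (((hΛ g).add (hΛ g')).congr fun n => ?_)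
      rw [← integral_add (hint g n) (hint g' n)]
      rfl
    map_smul' c g := by
      refine tendsto_nhds_unique (hΛ (c • g)) (((hΛ g).const_smul c).congr fun n => ?_)
      rw [← integral_smul]
      rfl
    monotone' g g' hgg' := le_of_tendsto_of_tendsto' (hΛ g) (hΛ g') fun n =>
      integral_mono (hint g n) (hint g' n) hgg' }
  refine ⟨RealRMK.rieszMeasure Λ', inferInstance, fun g l hl => ?_⟩
  rw [RealRMK.integral_rieszMeasure]
  exact tendsto_nhds_unique (hΛ g) (hl.mono_left (by
    rw [← Nat.cofinite_eq_atTop]; exact hyperfilter_le_cofinite))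

/-- Uniformly bounded test functions converging to the indicator of a compact set. -/
theorem IsCompact.exists_contDiff_tendsto_indicator {K : Set ℂ} (hK : IsCompact K) :
    ∃ g : ℕ → ℂ → ℝ, (∀ n, ContDiff ℝ (⊤ : ℕ∞) (g n)) ∧ (∀ n, HasCompactSupport (g n)) ∧
      (∀ n x, ‖g n x‖ ≤ 1) ∧
      ∀ x, Tendsto (fun n => g n x) atTop (𝓝 (K.indicator (fun _ => (1 : ℝ)) x)) := by
  obtain ⟨u, -, u_pos, u_lim⟩ := exists_seq_strictAnti_tendsto (0 : ℝ)
  have : ∀ n, ∃ g : ℂ → ℝ, Function.support g = Metric.thickening (u n) K ∧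
      ContDiff ℝ (⊤ : ℕ∞) g ∧ Set.range g ⊆ Set.Icc 0 1 ∧ ∀ x ∈ K, g x = 1 := by
    intro n
    rcases exists_contMDiff_support_eq_eq_one_iff (n := (⊤ : ℕ∞))
      (modelWithCornersSelf ℝ ℂ)
      Metric.isOpen_thickening hK.isClosed
      (Metric.self_subset_thickening (u_pos n) K) with ⟨g, g_smooth, g_range, g_supp, hg⟩
    exact ⟨g, g_supp, g_smooth.contDiff, g_range, fun x hx => (hg x).1 hx⟩
  choose g g_supp g_diff g_range hg using this
  refine ⟨g, g_diff, fun n => ?_, fun n x => ?_, fun x => ?_⟩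
  · exact HasCompactSupport.of_support_subset_isCompact
      (hK.cthickening (r := u n))
      ((g_supp n).trans_subset (Metric.thickening_subset_cthickening _ _))
  · have := g_range n (Set.mem_range_self x)
    rw [Real.norm_of_nonneg this.1]
    exact this.2
  · by_cases hx : x ∈ K
    · simp [hx, hg _ x hx]
    · rw [Set.indicator_of_notMem hx]
      apply tendsto_const_nhds.congr'
      obtain ⟨ε, εpos, hε⟩ : ∃ ε, 0 < ε ∧ x ∉ Metric.thickening ε K := by
        rw [← hK.isClosed.closure_eq, Metric.closure_eq_iInter_thickening K] at hx
        simpa using hx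
      filter_upwards [(tendsto_order.1 u_lim).2 _ εpos] with n hn
      by_contra h
      have : x ∈ Metric.thickening (u n) K := by
        rw [← g_supp]
        exact fun h0 => h h0.symm
      exact hε (Metric.thickening_mono hn.le K this)

theorem tendsto_integral_of_tendsto_indicator {g : ℕ → ℂ → ℝ} {K : Set ℂ} (hK : MeasurableSet K)
    (hg : ∀ n, Continuous (g n)) (hb : ∀ n x, ‖g n x‖ ≤ 1)
    (ht : ∀ x, Tendsto (fun n => g n x) atTop (𝓝 (K.indicator (fun _ => (1 : ℝ)) x)))
    (m : Measure ℂ) [IsFiniteMeasure m] :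
    Tendsto (fun n => ∫ x, g n x ∂m) atTop (𝓝 (m.real K)) := by
  rw [← integral_indicator_one hK]
  exact tendsto_integral_of_dominated_convergence (fun _ => 1)
    (fun n => (hg n).aestronglyMeasurable) (integrable_const _)
    (fun n => Eventually.of_forall (hb n)) (Eventually.of_forall ht)

theorem measure_eq_iSup_inter_closedBall {F : Set ℂ} (m : Measure ℂ) :
    m F = ⨆ n : ℕ, m (F ∩ Metric.closedBall 0 n) := by
  rw [← Monotone.measure_iUnion, ← Set.inter_iUnion, Metric.iUnion_closedBall_nat, Set.inter_univ]
  intro a b hab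
  exact Set.inter_subset_inter_right _ (Metric.closedBall_subset_closedBall (by exact_mod_cast hab))

/-- Finite measures on the plane are determined by smooth compactly supported test functions. -/
theorem MeasureTheory.Measure.ext_of_integral_contDiff {m m' : Measure ℂ} [IsFiniteMeasure m]
    [IsFiniteMeasure m']
    (h : ∀ φ : ℂ → ℝ, ContDiff ℝ (⊤ : ℕ∞) φ → HasCompactSupport φ →
      ∫ z, φ z ∂m = ∫ z, φ z ∂m') : m = m' := by
  have hcomp : ∀ K, IsCompact K → m K = m' K := by
    intro K hK
    obtain ⟨g, gd, gs, gb, gt⟩ := hK.exists_contDiff_tendsto_indicator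
    have t1 := tendsto_integral_of_tendsto_indicator hK.measurableSet (fun n => (gd n).continuous)
      gb gt m
    have t2 := tendsto_integral_of_tendsto_indicator hK.measurableSet (fun n => (gd n).continuous)
      gb gt m'
    have e : ∀ n, ∫ x, g n x ∂m = ∫ x, g n x ∂m' := fun n => h _ (gd n) (gs n)
    simp only [e] at t1
    exact (measureReal_eq_measureReal_iff).1 (tendsto_nhds_unique t1 t2)
  have hclosed : ∀ F, IsClosed F → m F = m' F := by
    intro F hF
    rw [measure_eq_iSup_inter_closedBall m, measure_eq_iSup_inter_closedBall m']
    exact iSup_congr fun n => hcomp _ ((isCompact_closedBall _ _).inter_left hF)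
  exact ext_of_generate_finite _ (BorelSpace.measurable_eq.trans borel_eq_generateFrom_isClosed)
    isPiSystem_isClosed (fun F hF => hclosed F hF) (hclosed _ isClosed_univ)

/-- A family of probability measures on the plane is measurable if its integrals against smooth
compactly supported test functions are. -/
theorem measurable_measure_of_measurable_integral_contDiff {Ω : Type*} [MeasurableSpace Ω]
    (κ : Ω → Measure ℂ) [∀ ω, IsProbabilityMeasure (κ ω)]
    (h : ∀ φ : ℂ → ℝ, ContDiff ℝ (⊤ : ℕ∞) φ → HasCompactSupport φ →
      Measurable fun ω => ∫ z, φ z ∂κ ω) : Measurable κ := by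
  have hcomp : ∀ K, IsCompact K → Measurable fun ω => κ ω K := by
    intro K hK
    obtain ⟨g, gd, gs, gb, gt⟩ := hK.exists_contDiff_tendsto_indicator
    have : Measurable fun ω => (κ ω).real K :=
      measurable_of_tendsto_metrizable (fun n => h _ (gd n) (gs n)) (tendsto_pi_nhds.2 fun ω =>
        tendsto_integral_of_tendsto_indicator hK.measurableSet (fun n => (gd n).continuous)
          gb gt (κ ω))
    simpa using this.ennreal_ofReal
  refine Measurable.measure_of_isPiSystem_of_isProbabilityMeasure
    (BorelSpace.measurable_eq.trans borel_eq_generateFrom_isClosed) isPiSystem_isClosed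
    fun F hF => ?_
  simp only [fun ω => measure_eq_iSup_inter_closedBall (F := F) (κ ω)]
  exact Measurable.iSup fun n => hcomp _ ((isCompact_closedBall _ _).inter_left hF)

/-! ### Distributional Laplacians of uniform limits. -/

theorem laplacian_comp_smul (t : ℝ) (φ : ℂ → ℝ) (z : ℂ) :
    (Δ fun z => φ (t • z)) z = t ^ 2 * (Δ φ) (t • z) := by
  have e : fderiv ℝ (fun z => φ (t • z)) = fun z => t • fderiv ℝ φ (t • z) :=
    funext fun z => by rw [fderiv_comp_smul]
  have e2 : fderiv ℝ (fun z => t • fderiv ℝ φ (t • z)) z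
      = t • t • fderiv ℝ (fderiv ℝ φ) (t • z) := by
    have := congrFun (fderiv_const_smul_field (𝕜 := ℝ) (f := fun z => fderiv ℝ φ (t • z)) t) z
    rw [Pi.smul_apply, fderiv_comp_smul (f := fderiv ℝ φ)] at this
    exact this
  rw [laplacian_complex_apply, laplacian_complex_apply, e, e2]
  simp only [smul_apply, smul_eq_mul]
  ring

/-- The total mass of a distributional Laplacian is stable under uniform approximation of the
potential. -/
theorem HasDistribLaplacian.measure_univ {u : ℂ → ℝ} {m : Measure ℂ}
    (h : HasDistribLaplacian u m) {v : ℕ → ℂ → ℝ} {ε : ℕ → ℝ} {M : ℝ} (hM : 0 ≤ M)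
    (hε : Tendsto ε atTop (𝓝 0)) (hv : ∀ n, ContDiff ℝ (⊤ : ℕ∞) (v n))
    (hpos : ∀ n z, 0 ≤ (Δ (v n)) z)
    (hmass : ∀ n, ∫⁻ z, ENNReal.ofReal ((Δ (v n)) z) = ENNReal.ofReal M)
    (hdist : ∀ n z, |v n z - u z| ≤ ε n) : m Set.univ = ENNReal.ofReal M := by
  obtain ⟨hu, hm, hΔ⟩ := h
  let φ : ContDiffBump (0 : ℂ) := ⟨1, 2, one_pos, one_lt_two⟩
  have φd : ContDiff ℝ (⊤ : ℕ∞) φ := φ.contDiff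
  let ψ : ℕ → ℂ → ℝ := fun N z => φ ((1 / ((N : ℝ) + 1)) • z)
  have tpos : ∀ N : ℕ, (0 : ℝ) < 1 / ((N : ℝ) + 1) := fun N => by positivity
  have ψd : ∀ N, ContDiff ℝ (⊤ : ℕ∞) (ψ N) := fun N => φd.comp (contDiff_id.const_smul _)
  have ψs : ∀ N, HasCompactSupport (ψ N) := fun N => φ.hasCompactSupport.comp_smul (tpos N).ne'
  have ψ0 : ∀ N z, 0 ≤ ψ N z := fun N z => φ.nonneg
  have ψ1 : ∀ N z, ψ N z ≤ 1 := fun N z => φ.le_one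
  have ψt : ∀ z, Tendsto (fun N => ψ N z) atTop (𝓝 1) := by
    intro z
    have t1 : Tendsto (fun N : ℕ => (1 / ((N : ℝ) + 1)) • z) atTop (𝓝 0) := by
      simpa using (tendsto_one_div_add_atTop_nhds_zero_nat (𝕜 := ℝ)).smul_const z
    have t2 := (φd.continuous.tendsto 0).comp t1
    rwa [φ.one_of_mem_closedBall (by simp [φ])] at t2
  have ψlim : ∀ (ν : Measure ℂ) [IsFiniteMeasure ν],
      Tendsto (fun N => ∫ z, ψ N z ∂ν) atTop (𝓝 (ν.real Set.univ)) := fun ν _ =>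
    tendsto_integral_of_tendsto_indicator MeasurableSet.univ (fun N => (ψd N).continuous)
      (fun N z => by rw [Real.norm_of_nonneg (ψ0 N z)]; exact ψ1 N z) (by simpa using ψt) ν
  set A := ∫ z, |(Δ ⇑φ) z| with hA
  -- In real dimension two the factor `t ^ 2` from the Laplacian cancels the Jacobian of the
  -- dilation, so the errors below do not depend on `N`.
  have ψA : ∀ N, ∫ z, |(Δ (ψ N)) z| = A := by
    intro N
    have e : ∀ z, |(Δ (ψ N)) z|
        = (1 / ((N : ℝ) + 1)) ^ 2 * |(Δ ⇑φ) ((1 / ((N : ℝ) + 1)) • z)| := by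
      intro z
      rw [laplacian_comp_smul, abs_mul, abs_of_nonneg (by positivity)]
    simp only [e]
    rw [integral_const_mul,
      Measure.integral_comp_smul (volume : Measure ℂ) (fun z => |(Δ ⇑φ : ℂ → ℝ) z|),
      Complex.finrank_real_complex, abs_of_nonneg (by positivity), smul_eq_mul, ← mul_assoc,
      mul_inv_cancel₀ (by positivity), one_mul]
  let ρ : ℕ → Measure ℂ := fun n => volume.withDensity fun z => ENNReal.ofReal ((Δ (v n)) z)
  have ρmass : ∀ n, ρ n Set.univ = ENNReal.ofReal M := fun n => by
    rw [withDensity_apply _ MeasurableSet.univ, setLIntegral_univ, hmass]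
  have ρfin : ∀ n, IsFiniteMeasure (ρ n) := fun n =>
    ⟨by rw [ρmass]; exact ENNReal.ofReal_lt_top⟩
  have ρint : ∀ n N, ∫ z, ψ N z ∂ρ n = ∫ z, v n z * (Δ (ψ N)) z := by
    intro n N
    rw [integral_mul_laplacian_comm (hv n) (ψd N) (ψs N),
      integral_withDensity_eq_integral_toReal_smul
        (hv n).continuous_laplacian.measurable.ennreal_ofReal
        (Eventually.of_forall fun _ => ENNReal.ofReal_lt_top)]
    refine integral_congr_ae (Eventually.of_forall fun z => ?_)
    simp only [smul_eq_mul]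
    rw [ENNReal.toReal_ofReal (hpos n z), mul_comm]
  have Δint : ∀ N (w : ℂ → ℝ), LocallyIntegrable w volume →
      Integrable fun z => w z * (Δ (ψ N)) z := fun N w hw =>
    hw.integrable_smul_right_of_hasCompactSupport (ψd N).continuous_laplacian (ψs N).laplacian
  have key : ∀ n N, |∫ z, ψ N z ∂ρ n - ∫ z, ψ N z ∂m| ≤ ε n * A := by
    intro n N
    rw [ρint, hΔ _ (ψd N) (ψs N),
      ← integral_sub (Δint N _ (hv n).continuous.locallyIntegrable) (Δint N _ hu), ← ψA N,
      ← integral_const_mul]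
    rw [← Real.norm_eq_abs]
    refine norm_integral_le_of_norm_le (((ψd N).continuous_laplacian.integrable_of_hasCompactSupport
      (ψs N).laplacian).abs.const_mul _) (Eventually.of_forall fun z => ?_)
    rw [← sub_mul, norm_mul, Real.norm_eq_abs, Real.norm_eq_abs]
    exact mul_le_mul_of_nonneg_right (hdist n z) (abs_nonneg _)
  -- Only local finiteness is known so far, while `ψlim` needs a finite measure. The estimate `key`
  -- at `n = 0` bounds the mass of every ball.
  have mfin : IsFiniteMeasure m := by
    refine ⟨lt_of_le_of_lt ?_ (ENNReal.ofReal_lt_top (r := M + ε 0 * A))⟩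
    rw [measure_eq_iSup_inter_closedBall m]
    refine iSup_le fun N => ?_
    rw [Set.univ_inter]
    have b1 : ∫ z, ψ N z ∂ρ 0 ≤ M := by
      have := integral_mono (μ := ρ 0)
        ((ψd N).continuous.integrable_of_hasCompactSupport (ψs N)) (integrable_const 1) (ψ1 N)
      rwa [integral_const, smul_eq_mul, mul_one, Measure.real, ρmass,
        ENNReal.toReal_ofReal hM] at this
    have b2 : ∫ z, ψ N z ∂m ≤ M + ε 0 * A := by
      have := (abs_le.1 (key 0 N)).1
      linarith
    have b3 : ∀ z ∈ Metric.closedBall (0 : ℂ) N, ψ N z = 1 := by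
      intro z hz
      refine φ.one_of_mem_closedBall ?_
      rw [mem_closedBall_zero_iff] at hz ⊢
      rw [norm_smul, Real.norm_of_nonneg (tpos N).le]
      change _ ≤ (1 : ℝ)
      rw [one_div, inv_mul_le_iff₀ (by positivity)]
      linarith
    have b4 : m.real (Metric.closedBall (0 : ℂ) N) ≤ ∫ z, ψ N z ∂m := by
      rw [← integral_indicator_one Metric.isClosed_closedBall.measurableSet]
      refine integral_mono ?_ ((ψd N).continuous.integrable_of_hasCompactSupport (ψs N))
        fun z => ?_
      · exact (integrable_indicator_iff Metric.isClosed_closedBall.measurableSet).2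
          (integrableOn_const (isCompact_closedBall _ _).measure_lt_top.ne)
      · refine Set.indicator_le' (fun z hz => (b3 z hz).ge) (fun z _ => ψ0 N z) z
    rw [← ENNReal.ofReal_toReal (isCompact_closedBall (0 : ℂ) N).measure_lt_top.ne]
    exact ENNReal.ofReal_le_ofReal (b4.trans b2)
  -- The cutoff is removed first, with `n` fixed; only then does `n` tend to infinity.
  have lim1 : ∀ n, |M - m.real Set.univ| ≤ ε n * A := by
    intro n
    have t := ((ψlim (ρ n)).sub (ψlim m)).abs
    rw [Measure.real, ρmass, ENNReal.toReal_ofReal hM] at t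
    exact le_of_tendsto' t (key n)
  have lim2 : |M - m.real Set.univ| ≤ 0 := by
    have t : Tendsto (fun n => ε n * A) atTop (𝓝 0) := by simpa using hε.mul_const A
    exact ge_of_tendsto' t lim1
  have e : M = m.real Set.univ := sub_eq_zero.1 (abs_nonpos_iff.1 lim2)
  rw [e, ofReal_measureReal]

/-- A uniform limit of smooth subharmonic functions of fixed mass has a distributional
Laplacian. -/
theorem exists_hasDistribLaplacian {u : ℂ → ℝ} (hu : Continuous u) {v : ℕ → ℂ → ℝ} {ε : ℕ → ℝ}
    {M : ℝ} (hM : 0 ≤ M) (hε : Tendsto ε atTop (𝓝 0)) (hv : ∀ n, ContDiff ℝ (⊤ : ℕ∞) (v n))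
    (hpos : ∀ n z, 0 ≤ (Δ (v n)) z)
    (hmass : ∀ n, ∫⁻ z, ENNReal.ofReal ((Δ (v n)) z) = ENNReal.ofReal M)
    (hdist : ∀ n z, |v n z - u z| ≤ ε n) : ∃ m, HasDistribLaplacian u m := by
  obtain ⟨m, hm, hlim⟩ := exists_vague_limit
    (fun n => (volume : Measure ℂ).withDensity fun z => ENNReal.ofReal ((Δ (v n)) z)) hM
    (fun n => by rw [withDensity_apply _ MeasurableSet.univ, setLIntegral_univ, hmass])
  refine ⟨m, hu.locallyIntegrable, hm, fun φ φd φs => ?_⟩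
  refine hlim ⟨⟨φ, φd.continuous⟩, φs⟩ _ ?_
  have e : ∀ n, ∫ z, φ z ∂((volume : Measure ℂ).withDensity fun z => ENNReal.ofReal ((Δ (v n)) z))
      = ∫ z, v n z * (Δ φ) z := by
    intro n
    rw [integral_mul_laplacian_comm (hv n) φd φs,
      integral_withDensity_eq_integral_toReal_smul
        (hv n).continuous_laplacian.measurable.ennreal_ofReal
        (Eventually.of_forall fun _ => ENNReal.ofReal_lt_top)]
    refine integral_congr_ae (Eventually.of_forall fun z => ?_)
    simp only [smul_eq_mul]
    rw [ENNReal.toReal_ofReal (hpos n z), mul_comm]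
  refine Tendsto.congr (fun n => (e n).symm) ?_
  have hc : Integrable (Δ φ) :=
    φd.continuous_laplacian.integrable_of_hasCompactSupport φs.laplacian
  have hi : ∀ w : ℂ → ℝ, Continuous w → Integrable fun z => w z * (Δ φ) z := fun w hw =>
    (hw.mul φd.continuous_laplacian).integrable_of_hasCompactSupport φs.laplacian.mul_left
  rw [tendsto_iff_dist_tendsto_zero]
  refine squeeze_zero (g := fun n => ε n * ∫ z, |(Δ φ) z|) (fun _ => dist_nonneg) (fun n => ?_)
    (by simpa using hε.mul_const (∫ z, |(Δ φ) z|))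
  rw [Real.dist_eq, ← integral_sub (hi _ (hv n).continuous) (hi _ hu), ← integral_const_mul]
  rw [← Real.norm_eq_abs]
  refine norm_integral_le_of_norm_le (hc.abs.const_mul _) (Eventually.of_forall fun z => ?_)
  rw [← sub_mul, norm_mul, Real.norm_eq_abs, Real.norm_eq_abs]
  exact mul_le_mul_of_nonneg_right (hdist n z) (abs_nonneg _)

/-! ### Equilibrium measures and invariance under the skew product. -/

namespace BoundedQuadraticSystem

variable {Ω : Type*} [MeasurableSpace Ω] {P : Measure Ω} (S : BoundedQuadraticSystem Ω P)

theorem hasDistribLaplacian_green (ω : Ω) :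
    HasDistribLaplacian (S.green ω) (distribLaplacian (S.green ω)) := by
  have h : ∃ m, HasDistribLaplacian (S.green ω) m :=
    exists_hasDistribLaplacian (S.continuous_green ω) (by positivity) S.tendsto_rate_div
      (fun n => S.contDiff_approxGreen n ω) (fun n => S.laplacian_approxGreen_nonneg n ω)
      (fun n => S.lintegral_laplacian_approxGreen n ω)
      (fun n => S.abs_approxGreen_sub_green_le n ω)
  rw [distribLaplacian, dif_pos h]
  exact h.choose_spec

instance isProbabilityMeasure_equilibriumMeasure (ω : Ω) :
    IsProbabilityMeasure (S.equilibriumMeasure ω) := by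
  constructor
  rw [equilibriumMeasure, Measure.smul_apply, smul_eq_mul,
    (S.hasDistribLaplacian_green ω).measure_univ (by positivity) S.tendsto_rate_div
      (fun n => S.contDiff_approxGreen n ω) (fun n => S.laplacian_approxGreen_nonneg n ω)
      (fun n => S.lintegral_laplacian_approxGreen n ω)
      (fun n => S.abs_approxGreen_sub_green_le n ω), ← ENNReal.ofReal_mul (by positivity),
    one_div_mul_cancel (by positivity), ENNReal.ofReal_one]

/-- Smooth test functions determine a finite measure, so this formula makes the choice inside
`distribLaplacian` harmless: measurability in `ω` and equivariance are both read off from it. -/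
theorem integral_equilibriumMeasure (ω : Ω) {φ : ℂ → ℝ} (hφ : ContDiff ℝ (⊤ : ℕ∞) φ)
    (hc : HasCompactSupport φ) :
    ∫ z, φ z ∂S.equilibriumMeasure ω
      = 1 / (2 * Real.pi) * ∫ z, S.green ω z * (Δ φ) z := by
  rw [equilibriumMeasure, integral_smul_measure, (S.hasDistribLaplacian_green ω).2.2 φ hφ hc,
    ENNReal.toReal_ofReal (by positivity), smul_eq_mul]

theorem measurable_equilibriumMeasure : Measurable S.equilibriumMeasure := by
  refine measurable_measure_of_measurable_integral_contDiff _ fun φ hφ hc => ?_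
  simp only [S.integral_equilibriumMeasure _ hφ hc]
  refine Measurable.const_mul ?_ _
  have hm : Measurable fun p : Ω × ℂ => S.green p.1 p.2 * (Δ φ) p.2 :=
    S.measurable_green.mul (hφ.continuous_laplacian.measurable.comp measurable_snd)
  exact hm.stronglyMeasurable.integral_prod_right'.measurable

/-- Equivariance of the equilibrium measures. -/
theorem map_equilibriumMeasure (ω : Ω) :
    (S.equilibriumMeasure ω).map (S.f ω) = S.equilibriumMeasure (S.shift ω) := by
  have hcd : ContDiff ℝ (⊤ : ℕ∞) fun z : ℂ => z ^ 2 + S.c ω := by fun_prop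
  have hm : Measurable (S.f ω) := hcd.continuous.measurable
  have : IsProbabilityMeasure ((S.equilibriumMeasure ω).map (S.f ω)) :=
    Measure.isProbabilityMeasure_map hm.aemeasurable
  refine Measure.ext_of_integral_contDiff fun φ hφ hc => ?_
  -- Properness of the polynomial keeps the pulled-back test function compactly supported.
  have hproper : Tendsto (fun z : ℂ => z ^ 2 + S.c ω) (cocompact ℂ) (cocompact ℂ) := by
    rw [← Metric.cobounded_eq_cocompact]
    have h1 : Tendsto (fun z : ℂ => z ^ 2) (Bornology.cobounded ℂ) (Bornology.cobounded ℂ) :=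
      tendsto_pow_cobounded_cobounded two_ne_zero
    rw [← tendsto_norm_atTop_iff_cobounded] at h1 ⊢
    refine tendsto_atTop_mono (fun z => ?_) (tendsto_atTop_add_const_right _ (-‖S.c ω‖) h1)
    have := norm_sub_le (z ^ 2 + S.c ω) (S.c ω)
    rw [add_sub_cancel_right] at this
    linarith
  have hc' : HasCompactSupport fun z => φ (z ^ 2 + S.c ω) := by
    rw [hasCompactSupport_iff_eventuallyEq] at hc ⊢
    rw [Filter.coclosedCompact_eq_cocompact] at hc ⊢
    exact hproper.eventually hc
  rw [integral_map hm.aemeasurable hφ.continuous.aestronglyMeasurable,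
    S.integral_equilibriumMeasure _ hφ hc]
  change ∫ z, φ (z ^ 2 + S.c ω) ∂S.equilibriumMeasure ω = _
  have hcomp : ContDiff ℝ (⊤ : ℕ∞) fun z => φ (z ^ 2 + S.c ω) := hφ.comp hcd
  rw [S.integral_equilibriumMeasure _ hcomp hc']
  congr 1
  -- The functional equation turns the integrand into a pullback times the Jacobian; its factor `1 /
  -- 2` will cancel the degree.
  have e : ∀ z, S.green ω z * (Δ fun z => φ (z ^ 2 + S.c ω)) z
      = 1 / 2 * ((fun w => S.green (S.shift ω) w * (Δ φ) w) (z ^ 2 + S.c ω) * ‖2 * z‖ ^ 2) := by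
    intro z
    simp only [laplacian_comp_sq_add hφ, green_shift]
    ring
  have hcont : Continuous fun w => S.green (S.shift ω) w * (Δ φ) w :=
    (S.continuous_green _).mul hφ.continuous_laplacian
  have h := integral_comp_sq_add hcont.aestronglyMeasurable (S.c ω)
  calc ∫ z, S.green ω z * (Δ fun z => φ (z ^ 2 + S.c ω)) z
      = 1 / 2 * (2 * ∫ z, S.green (S.shift ω) z * (Δ φ) z) := by
        rw [← h, ← integral_const_mul]
        exact integral_congr_ae (Eventually.of_forall e)
    _ = _ := by ring

theorem measurable_fiber_measure {A : Set (Ω × ℂ)} (hA : MeasurableSet A) :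
    Measurable fun ω => S.equilibriumMeasure ω (Prod.mk ω ⁻¹' A) := by
  let κ : ProbabilityTheory.Kernel Ω ℂ := ⟨S.equilibriumMeasure, S.measurable_equilibriumMeasure⟩
  have : ProbabilityTheory.IsMarkovKernel κ := ⟨S.isProbabilityMeasure_equilibriumMeasure⟩
  exact ProbabilityTheory.Kernel.measurable_kernel_prodMk_left (κ := κ) hA

theorem globalMeasure_apply {A : Set (Ω × ℂ)} (hA : MeasurableSet A) :
    S.globalMeasure A = ∫⁻ ω, S.equilibriumMeasure ω (Prod.mk ω ⁻¹' A) ∂P := by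
  have e : ∀ (ω : Ω) {B : Set (Ω × ℂ)}, MeasurableSet B →
      (S.equilibriumMeasure ω).map (Prod.mk ω) B = S.equilibriumMeasure ω (Prod.mk ω ⁻¹' B) :=
    fun ω B hB => Measure.map_apply measurable_prodMk_left hB
  have hm : Measurable fun ω => (S.equilibriumMeasure ω).map (Prod.mk ω) :=
    Measure.measurable_of_measurable_coe _ fun B hB => by
      simpa only [e _ hB] using S.measurable_fiber_measure hB
  rw [globalMeasure, Measure.bind_apply hA hm.aemeasurable]
  simp only [e _ hA]

theorem measurable_skewProduct : Measurable S.skewProduct :=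
  (S.shift.measurable.comp measurable_fst).prodMk
    ((measurable_snd.pow_const 2).add (S.measurable_c.comp measurable_fst))

/-- The fiber of the preimage of `A` over `ω` is the `f_ω`-preimage of the fiber of `A` over `σ ω`.
Equivariance gives it the measure of the latter, and `σ`-invariance of `P` removes the shift after
integration. -/
theorem measurePreserving_skewProduct :
    MeasurePreserving S.skewProduct S.globalMeasure S.globalMeasure := by
  refine ⟨S.measurable_skewProduct, Measure.ext fun A hA => ?_⟩
  rw [Measure.map_apply S.measurable_skewProduct hA,
    S.globalMeasure_apply (S.measurable_skewProduct hA), S.globalMeasure_apply hA,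
    ← S.ergodic_shift.toMeasurePreserving.lintegral_comp (S.measurable_fiber_measure hA)]
  refine lintegral_congr fun ω => ?_
  have hf : Measurable (S.f ω) := (measurable_id.pow_const 2).add_const _
  rw [← S.map_equilibriumMeasure ω, Measure.map_apply hf (measurable_prodMk_left hA)]
  rfl

end BoundedQuadraticSystem

end

theorem proposition3p4 {Ω : Type*} [MeasurableSpace Ω] (P : Measure Ω) [IsProbabilityMeasure P]
    [P.IsComplete] (S : BoundedQuadraticSystem Ω P) :
    -- the Green functions, the fiber measures and the global measure are well defined
    (∀ ω, ∀ z ∈ S.basin ω,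
      Tendsto (fun n : ℕ => 1 / (2 : ℝ) ^ n * Real.log ‖S.iter ω n z‖) atTop
        (𝓝 (S.green ω z))) ∧
    (∀ ω, HasDistribLaplacian (S.green ω) (distribLaplacian (S.green ω)) ∧
      IsProbabilityMeasure (S.equilibriumMeasure ω)) ∧
    (∀ B : Set ℂ, MeasurableSet B → Measurable fun ω => S.equilibriumMeasure ω B) ∧
    (∀ A : Set (Ω × ℂ), MeasurableSet A →
      S.globalMeasure A = ∫⁻ ω, S.equilibriumMeasure ω (Prod.mk ω ⁻¹' A) ∂P) ∧
    -- the skew product is measurable and preserves the global measure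
    MeasurePreserving S.skewProduct S.globalMeasure S.globalMeasure ∧
    (∀ A : Set (Ω × ℂ), NullMeasurableSet A S.globalMeasure →
      NullMeasurableSet (S.skewProduct ⁻¹' A) S.globalMeasure ∧
        S.globalMeasure (S.skewProduct ⁻¹' A) = S.globalMeasure A) := by
  refine ⟨S.tendsto_green, fun ω => ⟨S.hasDistribLaplacian_green ω, inferInstance⟩,
    fun B hB => (Measure.measurable_coe hB).comp S.measurable_equilibriumMeasure,
    fun A hA => S.globalMeasure_apply hA, S.measurePreserving_skewProduct, fun A hA =>
      ⟨hA.preimage S.measurePreserving_skewProduct.quasiMeasurePreserving,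
        S.measurePreserving_skewProduct.measure_preimage hA⟩⟩
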